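/- Let $\mathcal A,\mathcal B$ be two time-oriented Lorentzian spacetimes of dimension $d$, each with $N$ events: in each spacetime there are a future-directed timelike worldline $\gamma_0$, parametrised by proper time, and future-directed timelike worldlines $\gamma_1,\dots,\gamma_N$, each crossing $\gamma_0$ exactly once; the crossing with $\gamma_a$, at proper time $\tau_a$ of $\gamma_0$, is the event $\mathcal E_a$, and distinct events lie at distinct points. Events with the same label in $\mathcal A$ and $\mathcal B$ are identified. Put $s_{ab}=\operatorname{sgn}(\tau_b-\tau_a)$, order the events of each spacetime by $\mathcal E_a\prec\mathcal E_b$ iff $s_{ab}=1$, and put $$\mathfrak l^{\mathcal{AB}}=\sum_{1\le i<j\le N}s^{\mathcal A}_{ij}s^{\mathcal B}_{ij},\qquad \delta(\mathcal A,\mathcal B)=\sum_{1\le i<j\le N}\bigl|s^{\mathcal A}_{ij}-s^{\mathcal B}_{ij}\bigr|^0\quad(0^0:=0).$$ The causal order is definite if $\mathfrak l^{\mathcal{AB}}=\binom N2$, and maximally indefinite if $\mathfrak l^{\mathcal{AB}}=-\binom N2$. The knot of $(\mathcal A,\mathcal B)$ is given by the following oriented diagram. The events are vertices on a horizontal line,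 from left to right in the order of $\mathcal A$. The solid part of the curve starts at the bottom left (the first event of $\mathcal B$), goes up to the first vertex, along the line to the last vertex, and down to the bottom right (the last event of $\mathcal B$). From there the dashed part goes back to the start, visiting the vertices in the reversed order of $\mathcal B$ and staying below the line except for windings: it winds once around every vertex except that of the first event of $\mathcal B$, passing first under the solid line on one side of the vertex and then back over it on the other side, which is the side facing the vertex of the first event of $\mathcal B$; around the latter vertex it does not wind. Where two pieces of the dashed part cross, the one drawn first is the upper one. Let $\nabla(z)$ be the Alexander–Conway polynomial of this diagram ($\nabla=1$ for the unknot, $\nabla(L_+)=\nabla(L_-)+z\nabla(L_0)$), and $\nabla(z)_2$ its coefficient of $z^2$. If the causal order is definite or maximally indefinite, then $$\nabla(z)_2=\delta(\mathcal A,\mathcal B).$$ Moreover, $\nabla(z)_2=0$ if it is definite, and $\nabla(z)_2=N(N-1)/2$ if it is maximally indefinite. -/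

import Mathlib

open scoped Manifold ContDiff

/-! ## Spacetimes, worldlines, events -/

/-- A time-oriented Lorentzian metric (signature `(-,+,…,+)`) on a smooth `d`-dimensional manifold. -/
structure LorentzianMetric (d : ℕ) (M : Type*) [TopologicalSpace M]
    [ChartedSpace (EuclideanSpace ℝ (Fin d)) M] [IsManifold (𝓡 d) ∞ M] where
  /-- The metric tensor. -/
  val (p : M) : TangentSpace (𝓡 d) p →L[ℝ] TangentSpace (𝓡 d) p →L[ℝ] ℝ
  symm (p : M) (v w : TangentSpace (𝓡 d) p) : val p v w = val p w v
  /-- At every point there is a negative direction, and the metric is positive definite on its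
  orthogonal complement. -/
  lorentzian (p : M) : ∃ v : TangentSpace (𝓡 d) p, val p v v < 0 ∧
    ∀ w : TangentSpace (𝓡 d) p, val p v w = 0 → w ≠ 0 → 0 < val p w w
  smooth : ContMDiff (𝓡 d)
    ((𝓡 d).prod 𝓘(ℝ, EuclideanSpace ℝ (Fin d) →L[ℝ] EuclideanSpace ℝ (Fin d) →L[ℝ] ℝ)) ∞
    (fun p ↦ Bundle.TotalSpace.mk'
      (EuclideanSpace ℝ (Fin d) →L[ℝ] EuclideanSpace ℝ (Fin d) →L[ℝ] ℝ)
      (E := fun p : M ↦ TangentSpace (𝓡 d) p →L[ℝ] TangentSpace (𝓡 d) p →L[ℝ] ℝ) p (val p))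
  /-- The time orientation: a continuous timelike vector field, pointing to the future. -/
  future (p : M) : TangentSpace (𝓡 d) p
  future_timelike (p : M) : val p (future p) (future p) < 0
  future_continuous : Continuous
    (fun p ↦ (⟨p, future p⟩ : TangentBundle (𝓡 d) M))

section Spacetime

variable {d : ℕ} {M : Type*} [TopologicalSpace M]
  [ChartedSpace (EuclideanSpace ℝ (Fin d)) M] [IsManifold (𝓡 d) ∞ M]

/-- The velocity `γ'(s)` of a parametrised curve. -/
noncomputable def velocity (γ : ℝ → M) (s : ℝ) : TangentSpace (𝓡 d) (γ s) :=
  mfderiv 𝓘(ℝ, ℝ) (𝓡 d) γ s (1 : ℝ)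

/-- A future-directed timelike worldline, parametrised by an open interval. -/
structure Worldline (g : LorentzianMetric d M) where
  domain : Set ℝ
  isOpen_domain : IsOpen domain
  ordConnected_domain : domain.OrdConnected
  toFun : ℝ → M
  smooth : ContMDiffOn 𝓘(ℝ, ℝ) (𝓡 d) ∞ toFun domain
  timelike : ∀ s ∈ domain, g.val (toFun s) (velocity toFun s) (velocity toFun s) < 0
  future_directed : ∀ s ∈ domain, g.val (toFun s) (g.future (toFun s)) (velocity toFun s) < 0

end Spacetime

/-- A classical spacetime `(M, g)` with `N` events: the worldline `γ₀` of a test particle,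
parametrised by proper time (`c` is the speed of light), and worldlines `γ a`, each of
which crosses `γ₀` exactly once. The crossing of `γ a` with `γ₀` is the event `a`; it occurs at the
proper time `τ a`, at the point `γ₀ (τ a)`. In two spacetimes with `N` events the same label `a`
refers to the same physical event. -/
structure EventSpacetime (c : ℝ) (d N : ℕ) (M : Type*) [TopologicalSpace M]
    [ChartedSpace (EuclideanSpace ℝ (Fin d)) M] [IsManifold (𝓡 d) ∞ M] where
  g : LorentzianMetric d M
  γ₀ : Worldline g
  proper_time : ∀ t ∈ γ₀.domain,
    g.val (γ₀.toFun t) (velocity γ₀.toFun t) (velocity γ₀.toFun t) = -c ^ 2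
  γ : Fin N → Worldline g
  τ : Fin N → ℝ
  /-- `τ a` is the one and only proper time at which `γ₀` meets `γ a`. -/
  crossing : ∀ a t, (t ∈ γ₀.domain ∧ ∃ s ∈ (γ a).domain, (γ a).toFun s = γ₀.toFun t) ↔ t = τ a
  /-- Distinct events are located at distinct points. -/
  distinct : Function.Injective fun a ↦ γ₀.toFun (τ a)

/-! ## Causal order and its quantifiers -/

section CausalOrder

variable {c : ℝ} {d N : ℕ} {M M' : Type*}
  [TopologicalSpace M] [ChartedSpace (EuclideanSpace ℝ (Fin d)) M] [IsManifold (𝓡 d) ∞ M]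
  [TopologicalSpace M'] [ChartedSpace (EuclideanSpace ℝ (Fin d)) M'] [IsManifold (𝓡 d) ∞ M']

/-- The causal order `s_ab = sgn (τ_b - τ_a)` of two events. -/
noncomputable def causalOrder (A : EventSpacetime c d N M) (a b : Fin N) : ℤ :=
  (SignType.sign (A.τ b - A.τ a) : ℤ)

/-- The ordered collection of events: `orderedEvents A i` is the `i`-th event (counted from `0`) in
the order `≺` given by `a ≺ b` iff `s_ab = 1`. -/
noncomputable def orderedEvents (A : EventSpacetime c d N M) : Equiv.Perm (Fin N) :=
  Tuple.sort A.τ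

theorem orderedEvents_spec (A : EventSpacetime c d N M) (i j : Fin N) :
    i < j ↔ causalOrder A (orderedEvents A i) (orderedEvents A j) = 1 := by
  have hinj : Function.Injective A.τ := fun a b h ↦ A.distinct (by simp only [h])
  have hmono : StrictMono (A.τ ∘ Tuple.sort A.τ) :=
    (Tuple.monotone_sort A.τ).strictMono_of_injective
      (hinj.comp (Tuple.sort A.τ).injective)
  rw [← hmono.lt_iff_lt, causalOrder, orderedEvents, ← sub_pos, ← sign_eq_one_iff]
  simp only [Function.comp_apply]
  rcases SignType.sign (A.τ (Tuple.sort A.τ j) - A.τ (Tuple.sort A.τ i)) with _ | _ | _ <;> decide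

/-- The pairwise causal order. -/
noncomputable def pairwiseOrder (A : EventSpacetime c d N M) (B : EventSpacetime c d N M')
    (a b : Fin N) : ℤ :=
  causalOrder A a b * causalOrder B a b

/-- The longitudinal causal order, the sum of the pairwise causal orders over all pairs `i < j`. -/
noncomputable def longitudinalOrder (A : EventSpacetime c d N M) (B : EventSpacetime c d N M') : ℤ :=
  ∑ i, ∑ j ∈ Finset.Ioi i, pairwiseOrder A B i j

/-- Definite (longitudinal) causal order. -/
def IsDefinite (A : EventSpacetime c d N M) (B : EventSpacetime c d N M') : Prop :=
  longitudinalOrder A B = (N.choose 2 : ℤ)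

/-- Maximally indefinite (longitudinal) causal order. -/
def IsMaximallyIndefinite (A : EventSpacetime c d N M) (B : EventSpacetime c d N M') : Prop :=
  longitudinalOrder A B = -(N.choose 2 : ℤ)

/-- `|x| ^ 0`, with the convention `0 ^ 0 = 0`. -/
def absPowZero (x : ℤ) : ℤ := if x = 0 then 0 else |x| ^ 0

/-- The causal indefiniteness `δ(A, B) = ∑_{i < j} |s_ij^A - s_ij^B| ^ 0`, where `0 ^ 0 = 0`. -/
noncomputable def causalIndefiniteness (A : EventSpacetime c d N M) (B : EventSpacetime c d N M') :
    ℤ :=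
  ∑ i, ∑ j ∈ Finset.Ioi i, absPowZero (causalOrder A i j - causalOrder B i j)

/-- `relativeOrder A B j` is the place in the order of `A` of the `j`-th event of `B`. -/
noncomputable def relativeOrder (A : EventSpacetime c d N M) (B : EventSpacetime c d N M') :
    Equiv.Perm (Fin N) :=
  (orderedEvents B).trans (orderedEvents A).symm

end CausalOrder

/-! ## Oriented link diagrams and the Alexander–Conway polynomial -/

/-- An oriented link diagram, with a base point on every component, given by its signed Gauss code:
for every component the list of the crossings that one passes when travelling once around it from
the base point, marked `true` for an over-passage and `false` for an under-passage, and the sign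
(writhe) of every crossing. In the code of a diagram every crossing occurs exactly twice, once as an
over-passage and once as an under-passage. -/
structure LinkDiagram (C : Type*) where
  components : List (List (C × Bool))
  sign : C → ℤˣ

namespace LinkDiagram

variable {C : Type*} [DecidableEq C]

/-- Exchange the over- and the under-passage of the crossing `c` in a list of passages. -/
def switchWord (c : C) (w : List (C × Bool)) : List (C × Bool) :=
  w.map fun x ↦ if x.1 = c then (x.1, !x.2) else x

/-- The diagram in which the crossing `c` is switched. -/
def switch (D : LinkDiagram C) (c : C) : LinkDiagram C where
  components := D.components.map (switchWord c)
  sign := Function.update D.sign c (-D.sign c)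

/-- Does the component pass the crossing `c`? -/
def Passes (c : C) (w : List (C × Bool)) : Prop := c ∈ w.map Prod.fst

instance (c : C) : DecidablePred (Passes c) := fun w ↦
  inferInstanceAs (Decidable (c ∈ w.map Prod.fst))

/-- The part of a component before the first passage of `c`. -/
def before (c : C) (w : List (C × Bool)) : List (C × Bool) := w.takeWhile fun x ↦ x.1 ≠ c

/-- The part of a component after the first passage of `c`. -/
def after (c : C) (w : List (C × Bool)) : List (C × Bool) := (w.dropWhile fun x ↦ x.1 ≠ c).tail

/-- The oriented smoothing at `c`. A component `u c v c w` is cut into `u w` and `v`; two components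
`u c v` and `u' c v'` are joined to `u v' u' v`. -/
def smoothWords (c : C) : List (List (C × Bool)) → List (List (C × Bool))
  | [] => []
  | w :: ws =>
    if Passes c w then
      if Passes c (after c w) then
        (before c w ++ after c (after c w)) :: before c (after c w) :: ws
      else
        match ws.find? fun v ↦ decide (Passes c v) with
        | some v =>
          (before c w ++ after c v ++ before c v ++ after c w) ::
            ws.eraseP fun v ↦ decide (Passes c v)
        | none => (before c w ++ after c w) :: ws
    else w :: smoothWords c ws

/-- The diagram in which the crossing `c` is smoothed (orientation-consistently). -/
def smooth (D : LinkDiagram C) (c : C) : LinkDiagram C where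
  components := smoothWords c D.components
  sign := D.sign

/-- The passages that one meets when travelling along all components, one after the other, each of
them from its base point. -/
def passages (D : LinkDiagram C) : List (C × Bool) := D.components.flatten

/-- The crossing `c` is first passed from below. -/
def FirstUnder (l : List (C × Bool)) (c : C) : Prop :=
  l.find? (fun x ↦ decide (x.1 = c)) = some (c, false)

instance (l : List (C × Bool)) : DecidablePred (FirstUnder l) := fun c ↦
  inferInstanceAs (Decidable (l.find? (fun x ↦ decide (x.1 = c)) = some (c, false)))

/-- The first crossing of the diagram that is first passed from below, if there is one. -/
def firstUnder? (D : LinkDiagram C) : Option C :=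
  (D.passages.map Prod.fst).find? fun c ↦ decide (FirstUnder D.passages c)

/-- The number of crossings that are first passed from below. -/
def underCount (D : LinkDiagram C) : ℕ :=
  ((D.passages.map Prod.fst).toFinset.filter (FirstUnder D.passages)).card

theorem length_before_after {c : C} {w : List (C × Bool)} (h : Passes c w) :
    (before c w).length + (after c w).length + 1 = w.length := by
  induction w with
  | nil => simp [Passes] at h
  | cons x w ih =>
    by_cases hx : x.1 = c
    · simp [before, after, hx]
    · have : Passes c w := by
        simpa [Passes, Ne.symm hx] using h
      have := ih this
      simp [before, after, hx] at this ⊢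
      omega

theorem length_eraseP_find {c : C} {ws : List (List (C × Bool))} {v : List (C × Bool)}
    (h : ws.find? (fun v ↦ decide (Passes c v)) = some v) :
    (ws.eraseP fun v ↦ decide (Passes c v)).flatten.length + v.length = ws.flatten.length := by
  induction ws with
  | nil => simp at h
  | cons u ws ih =>
    by_cases hu : Passes c u
    · simp [hu] at h
      subst h
      rw [List.eraseP_cons_of_pos (by simpa using hu)]
      simp only [List.flatten_cons, List.length_append]
      omega
    · simp only [hu, decide_false, List.find?_cons_of_neg, Bool.false_eq_true, not_false_eq_true]
        at h
      have := ih h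
      simp [hu] at this ⊢
      omega

theorem length_smoothWords {c : C} {ws : List (List (C × Bool))}
    (h : c ∈ ws.flatten.map Prod.fst) :
    (smoothWords c ws).flatten.length < ws.flatten.length := by
  induction ws with
  | nil => simp at h
  | cons w ws ih =>
    unfold smoothWords
    split_ifs with h1 h2
    · have := length_before_after h1
      have := length_before_after h2
      simp only [List.flatten_cons, List.length_append]
      omega
    · have h3 := length_before_after h1
      split
      · rename_i v hv
        have h4 := length_eraseP_find hv
        have h5 : Passes c v := by simpa using List.find?_some hv
        have h6 := length_before_after h5
        simp only [List.flatten_cons, List.length_append] at h4 ⊢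
        omega
      · simp only [List.flatten_cons, List.length_append]
        omega
    · have : c ∈ ws.flatten.map Prod.fst := by
        rw [List.flatten_cons, List.map_append, List.mem_append] at h
        exact h.resolve_left h1
      have := ih this
      simp only [List.flatten_cons, List.length_append]
      omega

theorem passages_switch (D : LinkDiagram C) (c : C) :
    (D.switch c).passages = switchWord c D.passages := by
  have : ∀ l : List (List (C × Bool)),
      (l.map (switchWord c)).flatten = switchWord c l.flatten := by
    intro l
    induction l with
    | nil => rfl
    | cons w l ih => simp [ih, switchWord]
  exact this D.components

theorem firstUnder_switchWord {l : List (C × Bool)} {c e : C} :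
    FirstUnder (switchWord c l) e ↔
      if e = c then l.find? (fun x ↦ decide (x.1 = c)) = some (c, true) else FirstUnder l e := by
  induction l with
  | nil => simp [FirstUnder, switchWord]
  | cons x l ih =>
    obtain ⟨x, b⟩ := x
    unfold FirstUnder switchWord at *
    by_cases hxe : x = e
    · subst hxe
      by_cases hxc : x = c
      · subst hxc
        cases b <;> simp
      · simp [hxc]
    · have hx : ∀ q : Prop, [Decidable q] → (if q then (x, !b) else (x, b)).1 = x := by
        intro q _
        split_ifs <;> rfl
      rw [List.map_cons, List.find?_cons_of_neg (by simp [hx, hxe]), ih]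
      by_cases hec : e = c
      · subst hec
        simp [hxe]
      · simp [hec, hxe]

theorem firstUnder?_spec {D : LinkDiagram C} {c : C} (h : D.firstUnder? = some c) :
    c ∈ D.passages.map Prod.fst ∧ FirstUnder D.passages c :=
  ⟨List.mem_of_find?_eq_some h, by simpa using List.find?_some h⟩

theorem length_passages_switch (D : LinkDiagram C) (c : C) :
    (D.switch c).passages.length = D.passages.length := by
  rw [passages_switch, switchWord, List.length_map]

theorem underCount_switch {D : LinkDiagram C} {c : C} (h : D.firstUnder? = some c) :
    (D.switch c).underCount < D.underCount := by
  obtain ⟨hc, hu⟩ := firstUnder?_spec h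
  apply Finset.card_lt_card
  rw [Finset.ssubset_iff_of_subset]
  · refine ⟨c, by simpa using ⟨by simpa using hc, hu⟩, ?_⟩
    rw [Finset.mem_filter, passages_switch, firstUnder_switchWord, if_pos rfl]
    intro h'
    have hu' : D.passages.find? (fun x ↦ decide (x.1 = c)) = some (c, false) := hu
    rw [hu'] at h'
    simp at h'
  · intro e he
    rw [Finset.mem_filter, passages_switch, firstUnder_switchWord] at he
    have hm : (switchWord c D.passages).map Prod.fst = D.passages.map Prod.fst := by
      rw [switchWord, List.map_map]
      apply List.map_congr_left
      intro x _
      simp only [Function.comp_apply]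
      split_ifs <;> rfl
    rw [Finset.mem_filter]
    refine ⟨hm ▸ he.1, ?_⟩
    by_cases hec : e = c
    · subst hec
      exact hu
    · simpa [hec] using he.2

/-- The Alexander–Conway polynomial `∇(z) ∈ ℤ[z]` of a link diagram, computed by iterating the
skein relation `∇(L₊) = ∇(L₋) + z ∇(L₀)`, that is,
`∇(D) = ∇(D with c switched) + sign(c) z ∇(D with c smoothed)`, at the first crossing `c`
that is first passed from below. The iteration ends at descending diagrams, which are
diagrams of unlinks: `∇` is `1` for the unknot and `0` for an unlink of several components. -/
noncomputable def conway (D : LinkDiagram C) : Polynomial ℤ :=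
  match _h : D.firstUnder? with
  | none => if D.components.length = 1 then 1 else 0
  | some c => conway (D.switch c) +
      Polynomial.C ((D.sign c : ℤˣ) : ℤ) * Polynomial.X * conway (D.smooth c)
termination_by (D.passages.length, D.underCount)
decreasing_by
  · rw [length_passages_switch]
    exact Prod.Lex.right _ (underCount_switch _h)
  · exact Prod.Lex.left _ _ (length_smoothWords (firstUnder?_spec _h).1)

end LinkDiagram

/-! ## The knot of a pair of causal orders

The events of `A` are the vertices `0, …, N - 1` of a horizontal line (the top line), in their order
in `A`. The solid part of the curve starts at the first event of `B` (bottom left), goes up to the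
vertex `0`, along the line to the vertex `N - 1`, and down to the last event of `B` (bottom right).
From there the dashed part runs back to the start: it visits the vertices, in the reversed
order of `B`, staying below the line except where it winds around a vertex.

* It winds around every vertex `v` but that of the first event of `B`: it passes under the solid
  line on one side of `v`, and back over the solid line on the other side of `v`, the one that faces
  the vertex of the first event of `B`. Thus there are two crossings.
* It does not wind around the vertex of the first event of `B`, but runs down past it to
  the bottom left end point.
* Where two pieces of the dashed part cross, there is no winding, and
  the piece that is drawn first is the upper one.

Between two windings the dashed part is a piece in the half-plane below the line (piece `0` starts
at the bottom right end point, piece `N - 1` ends at the bottom left end point). The end points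
of the pieces are, from left to right, the bottom left end point `0`, the places `2v + 1` and
`2v + 2` to the left and to the right of the vertex `v`, and the bottom right end point `2N + 1`.
A piece with end points `a < b` goes vertically down from `a`, horizontally to the right to `b`,
and vertically up to `b` (or the same path backwards), the deeper the larger `b` is. So
pieces with end points `a < b` and `a' < b'`, `b < b'`, cross iff `a < a' < b`, and they do so once,
where the vertical line at `a'` meets the horizontal line of the former. -/

/-- The crossings of the diagram: where the dashed line passes under the solid one at the vertex `v`,
where it passes back over it at the vertex `v`, and where the pieces `i < j` of the
dashed line cross. -/
inductive DiagramCrossing where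
  | under (v : ℕ)
  | over (v : ℕ)
  | dashed (i j : ℕ)
  deriving DecidableEq

section Diagram

/-! Here `p : Equiv.Perm (Fin N)` maps `j` to the vertex of the `j`-th event of `B`. -/

variable {N : ℕ} (p : Equiv.Perm (Fin N))

/-- The vertex of the `j`-th event of `B`. -/
def vertexAt (j : ℕ) : ℕ := if h : j < N then (p ⟨j, h⟩ : ℕ) else 0

/-- The vertex that the dashed line visits after its piece `k`. -/
def visited (k : ℕ) : ℕ := vertexAt p (N - 1 - k)

/-- The place at which the dashed line passes under the solid one, at the vertex `v`. -/
def underPlace (v : ℕ) : ℕ := if v < vertexAt p 0 then 2 * v + 1 else 2 * v + 2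

/-- The place at which the dashed line passes back over the solid one, at the vertex `v`. -/
def overPlace (v : ℕ) : ℕ := if v < vertexAt p 0 then 2 * v + 2 else 2 * v + 1

/-- Starting point of the piece `k`. -/
def pieceStart (k : ℕ) : ℕ := if k = 0 then 2 * N + 1 else overPlace p (visited p (k - 1))

/-- End of the piece `k`. -/
def pieceEnd (k : ℕ) : ℕ := if k + 1 = N then 0 else underPlace p (visited p k)

/-- Left end point of the piece `k`. -/
def pieceLeft (k : ℕ) : ℕ := min (pieceStart p k) (pieceEnd p k)

/-- Right end point of the piece `k`. -/
def pieceRight (k : ℕ) : ℕ := max (pieceStart p k) (pieceEnd p k)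

/-- The pieces that cross the piece `i`, from the left to the right end point of the latter: first
the crossings on the vertical line at its left end point, from top to bottom, then the crossings on
its horizontal line. -/
def piecesCrossing (i : ℕ) : List ℕ :=
  ((List.range (2 * N + 2)).flatMap fun x ↦ (List.range N).filter fun j ↦
    pieceRight p j = x ∧ pieceLeft p j < pieceLeft p i ∧ pieceLeft p i < x ∧ x < pieceRight p i) ++
  ((List.range (2 * N + 2)).flatMap fun x ↦ (List.range N).filter fun j ↦
    pieceLeft p j = x ∧ pieceLeft p i < x ∧ x < pieceRight p i ∧ pieceRight p i < pieceRight p j)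

/-- The passages along the piece `i`, in its direction. -/
def piecePassages (i : ℕ) : List (DiagramCrossing × Bool) :=
  (if pieceStart p i < pieceEnd p i then piecesCrossing p i else (piecesCrossing p i).reverse).map
    fun j ↦ (DiagramCrossing.dashed (min i j) (max i j), decide (i < j))

/-- The passages along the solid line. -/
def solidPassages : List (DiagramCrossing × Bool) :=
  (List.range N).flatMap fun v ↦
    if v = vertexAt p 0 then []
    else if v < vertexAt p 0 then
      [(DiagramCrossing.under v, true), (DiagramCrossing.over v, false)]
    else [(DiagramCrossing.over v, false), (DiagramCrossing.under v, true)]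

/-- The passages along the dashed line: its pieces, and between them the windings. -/
def dashedPassages : List (DiagramCrossing × Bool) :=
  (List.range N).flatMap fun i ↦ piecePassages p i ++
    if i + 1 < N then [(DiagramCrossing.under (visited p i), false),
      (DiagramCrossing.over (visited p i), true)] else []

/-- `1` for a piece that runs from left to right, `-1` otherwise. -/
def pieceDirection (i : ℕ) : ℤˣ := if pieceStart p i < pieceEnd p i then 1 else -1

/-- The signs of the crossings: at a winding, the solid line runs to the right and the dashed line
runs upwards below it, or downwards above it, so that the sign is `1`. Where two pieces cross,
the one with the larger right end point runs downwards if it is directed to the right, and upwards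
if it is directed to the left, and the other one runs horizontally. -/
def crossingSign : DiagramCrossing → ℤˣ
  | .under _ => 1
  | .over _ => 1
  | .dashed i j => (if pieceRight p i < pieceRight p j then -1 else 1) *
      (pieceDirection p i * pieceDirection p j)

/-- The diagram, a closed curve: the solid line followed by the dashed line. -/
def permutationKnot : LinkDiagram DiagramCrossing where
  components := [solidPassages p ++ dashedPassages p]
  sign := crossingSign p

end Diagram

/-- The knot (diagram) associated with two spacetimes with `N` events. -/
noncomputable def causalKnot {c : ℝ} {d N : ℕ} {M M' : Type*}
    [TopologicalSpace M] [ChartedSpace (EuclideanSpace ℝ (Fin d)) M] [IsManifold (𝓡 d) ∞ M]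
    [TopologicalSpace M'] [ChartedSpace (EuclideanSpace ℝ (Fin d)) M'] [IsManifold (𝓡 d) ∞ M']
    (A : EventSpacetime c d N M) (B : EventSpacetime c d N M') : LinkDiagram DiagramCrossing :=
  permutationKnot (relativeOrder A B)

/-! Every pairwise order is `1` or `-1`, so an extremal longitudinal order forces all of them to
agree: the order of `B` is that of `A` if it is definite, and its reversal if it is maximally
indefinite. Only two permutations per `N` remain, the identity and the reversal, and `δ` is `0` or
`N.choose 2` accordingly.

The coefficient of `z²` comes from a Gauss diagram formula of Polyak–Viro type (`coeff_two_conway`):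
for a one-component Gauss word it is the sum of `sign c * sign d` over the pairs passed in the order
under `c`, over `d`, over `c`, under `d`. It is proved along the recursion that defines `conway`, so
neither invariance under Reidemeister moves nor planarity is used. In degree 0 the polynomial
detects whether there is one component; in degree 1 it gives, for two components, the linking
number, counted where the first passes under the second (`coeff_one_conway`). In degree 2, switching
the chosen crossing `c` destroys exactly the interlaced pairs `(c, d)`, and their contribution is
`sign c` times the linking number of the smoothing at `c`. This matching relies on `c` being the
earliest crossing that is first passed from below.

For the identity no two dashed pieces cross and no pair is interlaced. For the reversal, with `N = n
+ 1`, the only dashed crossing is that of the first piece with the last one. All signs are `1`; the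
interlaced pairs are `(over i, under j)` with `i < j < n` and `(over i, dashed 0 n)` with `i < n`,
which makes `n.choose 2 + n = N.choose 2` of them. -/

namespace LinkDiagram

variable {C : Type*}

/-! ### Gauss words -/

/-- Every passage occurs at most once, and the over- and the under-passage of a crossing occur
together. -/
def IsGaussWord (l : List (C × Bool)) : Prop :=
  l.Nodup ∧ ∀ c b, (c, b) ∈ l → (c, !b) ∈ l

theorem IsGaussWord.perm {l l' : List (C × Bool)} (h : IsGaussWord l) (hp : l.Perm l') :
    IsGaussWord l' :=
  ⟨hp.nodup_iff.1 h.1, fun c b hb ↦ hp.subset (h.2 c b (hp.symm.subset hb))⟩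

theorem IsGaussWord.mem_iff {l : List (C × Bool)} (h : IsGaussWord l) (c : C) :
    (c, true) ∈ l ↔ (c, false) ∈ l :=
  ⟨h.2 c true, h.2 c false⟩

theorem passes_iff {c : C} {w : List (C × Bool)} :
    Passes c w ↔ (c, false) ∈ w ∨ (c, true) ∈ w := by
  simp [Passes]

/-! ### Switching a crossing, and the order of first passages -/

variable [DecidableEq C]

/-- The passage `x` after switching the crossing `c`. -/
def switchPassage (c : C) (x : C × Bool) : C × Bool := if x.1 = c then (x.1, !x.2) else x

theorem switchPassage_involutive (c : C) : Function.Involutive (switchPassage c) := by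
  rintro ⟨a, b⟩
  by_cases h : a = c <;> simp [switchPassage, h]

theorem switchPassage_self (c : C) (b : Bool) : switchPassage c (c, b) = (c, !b) := by
  simp [switchPassage]

theorem switchPassage_of_ne {c a : C} (h : a ≠ c) (b : Bool) :
    switchPassage c (a, b) = (a, b) := by
  simp [switchPassage, h]

theorem mem_switchWord {c : C} {w : List (C × Bool)} {x : C × Bool} :
    x ∈ switchWord c w ↔ switchPassage c x ∈ w := by
  change x ∈ w.map (switchPassage c) ↔ _
  rw [List.mem_map]
  constructor
  · rintro ⟨y, hy, rfl⟩
    rwa [switchPassage_involutive c y]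
  · exact fun h ↦ ⟨_, h, switchPassage_involutive c x⟩

theorem idxOf_switchWord (c : C) (w : List (C × Bool)) (x : C × Bool) :
    (switchWord c w).idxOf x = w.idxOf (switchPassage c x) := by
  change (w.map (switchPassage c)).idxOf x = _
  induction w with
  | nil => simp
  | cons y w ih =>
    rw [List.map_cons, List.idxOf_cons, List.idxOf_cons, ih]
    have : (switchPassage c y == x) = (y == switchPassage c x) := by
      rw [Bool.eq_iff_iff, beq_iff_eq, beq_iff_eq]
      exact ⟨fun h ↦ by rw [← h, switchPassage_involutive c y],
        fun h ↦ by rw [h, switchPassage_involutive c x]⟩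
    rw [this]

theorem IsGaussWord.switchWord {l : List (C × Bool)} (h : IsGaussWord l) (c : C) :
    IsGaussWord (switchWord c l) := by
  refine ⟨h.1.map (switchPassage_involutive c).injective, fun e b he ↦ ?_⟩
  rw [mem_switchWord] at he ⊢
  by_cases hec : e = c
  · subst hec
    rw [switchPassage_self] at he ⊢
    exact h.2 _ _ he
  · rw [switchPassage_of_ne hec] at he ⊢
    exact h.2 _ _ he

/-- Replaces the search by an inequality of positions, to which `omega` applies. An absent passage
has the length of the word as its `idxOf`, so the equivalence needs no membership hypothesis. -/
theorem firstUnder_iff_idxOf_lt {l : List (C × Bool)} {c : C} :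
    FirstUnder l c ↔ l.idxOf (c, false) < l.idxOf (c, true) := by
  induction l with
  | nil => simp [FirstUnder]
  | cons x l ih =>
    obtain ⟨a, b⟩ := x
    unfold FirstUnder at *
    by_cases h : a = c
    · subst h
      cases b <;> simp
    · have h1 : ∀ b', ((a, b) == (c, b')) = false := by
        intro b'
        simp [h]
      rw [List.find?_cons_of_neg (by simpa using h), ih]
      simp [List.idxOf_cons, h1]

theorem FirstUnder.mem {l : List (C × Bool)} {c : C} (h : FirstUnder l c) : (c, false) ∈ l :=
  List.mem_of_find?_eq_some h

/-- The search runs along the passages, so no crossing that is first passed from below occurs before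
the chosen one. This minimality is what makes the bookkeeping in degree 2 work. -/
theorem idxOf_firstUnder?_le {D : LinkDiagram C} {c e : C} (h : D.firstUnder? = some c)
    (he : D.passages.idxOf (e, false) < D.passages.idxOf (e, true)) :
    D.passages.idxOf (c, false) ≤ D.passages.idxOf (e, false) := by
  rw [firstUnder?, List.find?_eq_some_iff_append] at h
  obtain ⟨hc, as, bs, hl, has⟩ := h
  rw [List.map_eq_append_iff] at hl
  obtain ⟨as', l₂, hl, rfl, h₂⟩ := hl
  rw [List.map_eq_cons_iff] at h₂
  obtain ⟨⟨c', b⟩, bs', rfl, rfl, -⟩ := h₂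
  have key : ∀ e b', FirstUnder D.passages e → (e, b') ∉ as' := by
    intro e b' he hmem
    have := has e (List.mem_map.2 ⟨_, hmem, rfl⟩)
    simp [he] at this
  have hc' : FirstUnder D.passages c' := by simpa using hc
  have hidx : ∀ e b', FirstUnder D.passages e → as'.length ≤ D.passages.idxOf (e, b') := by
    intro e b' he
    have := key e b' he
    rw [hl, List.idxOf_append_of_notMem this]
    omega
  have hcl : D.passages.idxOf (c', b) = as'.length := by
    rw [hl, List.idxOf_append_of_notMem (key _ _ hc'), List.idxOf_cons_self, add_zero]
  have h1 := firstUnder_iff_idxOf_lt.1 hc'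
  have h2 := hidx e false (firstUnder_iff_idxOf_lt.2 he)
  have h3 := hidx c' false hc'
  dsimp only
  cases b
  · omega
  · omega

/-! ### Smoothing -/

theorem exists_eq_before_append {c : C} {w : List (C × Bool)} (h : Passes c w) :
    ∃ b, w = before c w ++ (c, b) :: after c w ∧ ¬Passes c (before c w) := by
  induction w with
  | nil => simp [Passes] at h
  | cons x w ih =>
    obtain ⟨a, b⟩ := x
    by_cases hx : a = c
    · subst hx
      exact ⟨b, by simp [before, after], by simp [before, Passes]⟩
    · have : Passes c w := by simpa [Passes, Ne.symm hx] using h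
      obtain ⟨b', h1, h2⟩ := ih this
      refine ⟨b', ?_, ?_⟩
      · simpa [before, after, hx] using h1
      · simpa [before, Passes, hx, Ne.symm hx] using h2

theorem passes_after_iff {c : C} {w : List (C × Bool)} (hw : w.Nodup) (h : Passes c w) :
    Passes c (after c w) ↔ (c, false) ∈ w ∧ (c, true) ∈ w := by
  obtain ⟨b, h1, h2⟩ := exists_eq_before_append h
  generalize before c w = u at *
  generalize after c w = v at *
  subst h1
  rw [passes_iff] at h2 ⊢
  rw [List.nodup_append, List.nodup_cons] at hw
  have h3 := hw.2.1.1
  cases b <;> simp_all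

/-- Smoothing a mixed crossing joins the two components, smoothing a self-crossing makes three.
Since the first component is travelled first, a mixed crossing that is first passed from below has
its under-passage there. -/
theorem length_smoothWords_pair {c : C} {w₁ w₂ : List (C × Bool)} (h : IsGaussWord (w₁ ++ w₂))
    (hc : FirstUnder (w₁ ++ w₂) c) :
    (smoothWords c [w₁, w₂]).length = 1 ↔ (c, false) ∈ w₁ ∧ (c, true) ∈ w₂ := by
  have hnd := List.nodup_append.1 h.1
  have hF := hc.mem
  have hT := (h.mem_iff c).2 hF
  have hdis : ∀ b, (c, b) ∈ w₁ → (c, b) ∉ w₂ := fun b h1 h2 ↦ hnd.2.2 _ h1 _ h2 rfl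
  have hlt := firstUnder_iff_idxOf_lt.1 hc
  have hord : (c, false) ∈ w₂ → (c, true) ∉ w₁ := by
    intro h2 h1
    have h3 := fun h ↦ hdis false h h2
    rw [List.idxOf_append_of_notMem h3, List.idxOf_append_of_mem h1] at hlt
    have := List.idxOf_lt_length_of_mem h1
    omega
  rw [List.mem_append] at hF hT
  by_cases p1 : Passes c w₁
  · by_cases p2 : Passes c (after c w₁)
    · have := (passes_after_iff hnd.1 p1).1 p2
      have h4 := hdis true this.2
      simp [smoothWords, p1, p2, h4]
    · have h5 : ¬((c, false) ∈ w₁ ∧ (c, true) ∈ w₁) := fun h ↦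
        p2 ((passes_after_iff hnd.1 p1).2 h)
      have h6 := passes_iff.1 p1
      have p3 : Passes c w₂ := by
        rw [passes_iff]
        tauto
      have : (c, false) ∈ w₁ ∧ (c, true) ∈ w₂ := by tauto
      simp [smoothWords, p1, p2, p3, this]
  · have h6 := mt passes_iff.2 p1
    simp only [not_or] at h6
    have p3 : Passes c w₂ := passes_iff.2 (Or.inl (hF.resolve_left h6.1))
    have p4 : Passes c (after c w₂) :=
      (passes_after_iff hnd.2.1 p3).2 ⟨hF.resolve_left h6.1, hT.resolve_left h6.2⟩
    simp [smoothWords, p1, p3, p4, h6]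

theorem smoothWords_singleton {c : C} {w : List (C × Bool)} (h : IsGaussWord w)
    (hc : FirstUnder w c) :
    ∃ u v x, w = u ++ (c, false) :: v ++ (c, true) :: x ∧
      smoothWords c [w] = [u ++ x, v] := by
  have hF := hc.mem
  have hT := (h.mem_iff c).2 hF
  have p1 : Passes c w := passes_iff.2 (Or.inl hF)
  have p2 : Passes c (after c w) := (passes_after_iff h.1 p1).2 ⟨hF, hT⟩
  obtain ⟨b, h1, h2⟩ := exists_eq_before_append p1
  obtain ⟨b', h3, h4⟩ := exists_eq_before_append p2
  refine ⟨before c w, before c (after c w), after c (after c w), ?_, by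
    simp [smoothWords, p1, p2]⟩
  have hlt := firstUnder_iff_idxOf_lt.1 hc
  generalize before c (after c w) = v at *
  generalize after c (after c w) = x at *
  generalize before c w = u at *
  rw [h3] at h1
  rw [passes_iff, not_or] at h2 h4
  have hnd := h.1
  rw [h1] at hlt hnd
  rw [List.idxOf_append_of_notMem h2.1, List.idxOf_append_of_notMem h2.2] at hlt
  -- The two passages cannot be equal, and the first one must be the under-passage.
  cases b
  · cases b'
    · simp [List.nodup_append] at hnd
    · simpa using h1
  · simp at hlt

/-! ### The coefficients of the Conway polynomial -/

theorem conway_of_none {D : LinkDiagram C} (h : D.firstUnder? = none) :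
    D.conway = if D.components.length = 1 then 1 else 0 := by
  rw [conway]
  split <;> simp_all

theorem conway_of_some {D : LinkDiagram C} {c : C} (h : D.firstUnder? = some c) :
    D.conway = (D.switch c).conway +
      Polynomial.C ((D.sign c : ℤˣ) : ℤ) * Polynomial.X * (D.smooth c).conway := by
  rw [conway]
  split <;> simp_all

theorem coeff_succ_conway_of_some {D : LinkDiagram C} {c : C} (h : D.firstUnder? = some c)
    (n : ℕ) : D.conway.coeff (n + 1) = (D.switch c).conway.coeff (n + 1) +
      ((D.sign c : ℤˣ) : ℤ) * (D.smooth c).conway.coeff n := by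
  rw [conway_of_some h, Polynomial.coeff_add, mul_assoc, Polynomial.coeff_C_mul,
    Polynomial.coeff_X_mul]

/-- A property of all diagrams that holds for descending diagrams and passes from a diagram with
the first crossing switched to the diagram itself. -/
theorem switch_induction {P : LinkDiagram C → Prop} (h0 : ∀ D, D.firstUnder? = none → P D)
    (h1 : ∀ D c, D.firstUnder? = some c → P (D.switch c) → P D) (D : LinkDiagram C) : P D := by
  induction hn : D.underCount using Nat.strong_induction_on generalizing D with
  | _ n ih =>
    cases h : D.firstUnder? with
    | none => exact h0 D h
    | some c => exact h1 D c h (ih _ (hn ▸ underCount_switch h) _ rfl)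

/-- The smoothing term carries a factor `z`, and switching preserves the number of components. -/
theorem coeff_zero_conway (D : LinkDiagram C) :
    D.conway.coeff 0 = if D.components.length = 1 then 1 else 0 := by
  induction D using switch_induction with
  | h0 D h =>
    rw [conway_of_none h]
    split_ifs <;> simp
  | h1 D c h ih =>
    rw [conway_of_some h, Polynomial.coeff_add, ih]
    simp [switch, mul_assoc]

theorem not_firstUnder_of_none {D : LinkDiagram C} (h : D.firstUnder? = none) (c : C) :
    ¬FirstUnder D.passages c := by
  intro hc
  rw [firstUnder?, List.find?_eq_none] at h
  exact h c (List.mem_map.2 ⟨_, hc.mem, rfl⟩) (by simpa using hc)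

/-- The sum of the signs of the crossings (in `S`) at which `w₁` passes under `w₂`. -/
def underLinking (S : Finset C) (s : C → ℤˣ) (w₁ w₂ : List (C × Bool)) : ℤ :=
  ∑ d ∈ S, if (d, false) ∈ w₁ ∧ (d, true) ∈ w₂ then (s d : ℤ) else 0

/-- This is the linking number. Switching a mixed crossing removes its summand, and exactly then the
smoothing is connected and contributes the sign. A self-crossing alters neither side. A descending
diagram has no crossing with the first component below the second. -/
theorem coeff_one_conway {S : Finset C} (D : LinkDiagram C) {w₁ w₂ : List (C × Bool)}
    (hD : D.components = [w₁, w₂]) (hw : IsGaussWord (w₁ ++ w₂))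
    (hS : ∀ x ∈ w₁ ++ w₂, x.1 ∈ S) :
    D.conway.coeff 1 = underLinking S D.sign w₁ w₂ := by
  induction D using switch_induction generalizing w₁ w₂ with
  | h0 D h =>
    have hnone : ∀ d, ¬((d, false) ∈ w₁ ∧ (d, true) ∈ w₂) := by
      rintro d ⟨h1, h2⟩
      have h3 : (d, true) ∉ w₁ := fun h3 ↦ (List.nodup_append.1 hw.1).2.2 _ h3 _ h2 rfl
      refine not_firstUnder_of_none h d ?_
      have : D.passages = w₁ ++ w₂ := by simp [passages, hD]
      rw [this, firstUnder_iff_idxOf_lt, List.idxOf_append_of_mem h1,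
        List.idxOf_append_of_notMem h3]
      have := List.idxOf_lt_length_of_mem h1
      omega
    rw [conway_of_none h, hD, underLinking]
    simp [hnone]
  | h1 D c h ih =>
    have hp : D.passages = w₁ ++ w₂ := by simp [passages, hD]
    have hu := (firstUnder?_spec h).2
    rw [hp] at hu
    have hsw : (D.switch c).components = [switchWord c w₁, switchWord c w₂] := by
      simp [switch, hD]
    have happ : switchWord c w₁ ++ switchWord c w₂ = switchWord c (w₁ ++ w₂) := by
      simp [switchWord]
    have hcS : c ∈ S := hS _ hu.mem
    rw [coeff_succ_conway_of_some h 0, coeff_zero_conway, ih hsw (happ ▸ hw.switchWord c) ?_]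
    · have hsm : (D.smooth c).components = smoothWords c [w₁, w₂] := by rw [smooth, hD]
      rw [hsm]
      simp only [length_smoothWords_pair hw hu]
      rw [underLinking, underLinking]
      have hnot : ¬((c, true) ∈ w₁ ∧ (c, false) ∈ w₂) := by
        rintro ⟨h1, h2⟩
        have h3 : (c, false) ∉ w₁ := fun h3 ↦ (List.nodup_append.1 hw.1).2.2 _ h3 _ h2 rfl
        have hlt := firstUnder_iff_idxOf_lt.1 hu
        rw [List.idxOf_append_of_notMem h3, List.idxOf_append_of_mem h1] at hlt
        have := List.idxOf_lt_length_of_mem h1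
        omega
      -- Only the summand of `c` can change under the switch; by `hnot` it vanishes afterwards.
      rw [← Finset.sum_erase_add _ _ hcS, ← Finset.sum_erase_add _ _ hcS, add_assoc]
      congr 1
      · refine Finset.sum_congr rfl fun d hd ↦ ?_
        have hdc := Finset.ne_of_mem_erase hd
        simp [mem_switchWord, switchPassage_of_ne hdc, switch, Function.update_of_ne hdc]
      · simp [mem_switchWord, switchPassage_self, hnot]
    · rw [happ]
      intro x hx
      rw [mem_switchWord] at hx
      have := hS _ hx
      unfold switchPassage at this
      split_ifs at this <;> exact this

/-! ### Interlaced pairs and the second coefficient -/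

/-- The passages of `c` and `d` occur in the order: under `c`, over `d`, over `c`, under `d`. -/
def Interlaced (w : List (C × Bool)) (c d : C) : Prop :=
  w.idxOf (c, false) < w.idxOf (d, true) ∧ w.idxOf (d, true) < w.idxOf (c, true) ∧
    w.idxOf (c, true) < w.idxOf (d, false) ∧ w.idxOf (d, false) < w.length

instance (w : List (C × Bool)) (c d : C) : Decidable (Interlaced w c d) :=
  inferInstanceAs (Decidable (_ ∧ _))

theorem idxOf_append_lt_length_iff {l₁ l₂ : List (C × Bool)} {y : C × Bool} :
    (l₁ ++ l₂).idxOf y < l₁.length ↔ y ∈ l₁ := by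
  rw [List.idxOf_append]
  split_ifs with h
  · simp [h, List.idxOf_lt_length_of_mem h]
  · simp [h]

/-- Smoothing `c` gives the components `u ++ x` and `v`, so the crossings interlaced with `c` are
those counted by their linking number. The hypothesis `hd` rules out an under-passage in `u`, where
the cyclic component would satisfy the right side but the based word would not be interlaced. -/
theorem interlaced_iff_mem {u v x : List (C × Bool)} {c d : C}
    (hw : (u ++ (c, false) :: v ++ (c, true) :: x).Nodup)
    (hd : (d, false) ∈ u → (d, true) ∉ v) :
    Interlaced (u ++ (c, false) :: v ++ (c, true) :: x) c d ↔
      (d, false) ∈ u ++ x ∧ (d, true) ∈ v := by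
  generalize hl : u ++ (c, false) :: v ++ (c, true) :: x = w at hw ⊢
  -- The block containing a passage is found by comparing its position with the lengths of the
  -- successive prefixes of the word.
  have h1 : ∀ y, w.idxOf y < u.length + 1 ↔ y ∈ u ∨ y = (c, false) := by
    intro y
    have := @idxOf_append_lt_length_iff _ _ (u ++ [(c, false)]) (v ++ (c, true) :: x) y
    simpa [← hl] using this
  have h2 : ∀ y, w.idxOf y < u.length + (v.length + 1) ↔ y ∈ u ∨ y = (c, false) ∨ y ∈ v := by
    intro y
    have := @idxOf_append_lt_length_iff _ _ (u ++ (c, false) :: v) ((c, true) :: x) y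
    simpa [← hl] using this
  have h3 : ∀ y, w.idxOf y < u.length + (v.length + (1 + 1)) ↔
      y ∈ u ∨ y = (c, false) ∨ y ∈ v ∨ y = (c, true) := by
    intro y
    have := @idxOf_append_lt_length_iff _ _ (u ++ (c, false) :: v ++ [(c, true)]) x y
    simpa [← hl, add_assoc] using this
  have h4 : ∀ y, w.idxOf y < w.length ↔
      y ∈ u ∨ y = (c, false) ∨ y ∈ v ∨ y = (c, true) ∨ y ∈ x := by
    intro y
    rw [List.idxOf_lt_length_iff, ← hl]
    simp
  rw [← hl] at hw
  simp only [List.nodup_append, List.nodup_cons, List.mem_append, List.mem_cons] at hw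
  obtain ⟨⟨hu, ⟨hcv, hv⟩, huv⟩, ⟨hcx, hx⟩, huvx⟩ := hw
  have hcu : (c, false) ∉ u := fun h ↦ huv _ h _ (Or.inl rfl) rfl
  have hcu' : (c, true) ∉ u := fun h ↦ huvx _ (Or.inl h) _ (Or.inl rfl) rfl
  have hcv' : (c, true) ∉ v := fun h ↦ huvx _ (Or.inr (Or.inr h)) _ (Or.inl rfl) rfl
  have e1 : w.idxOf (c, false) = u.length := by
    rw [← hl, List.append_assoc, List.idxOf_append_of_notMem hcu]
    simp
  have e2 : w.idxOf (c, true) = u.length + (v.length + 1) := by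
    rw [← hl, List.idxOf_append_of_notMem]
    · simp
    · simp [hcu', hcv']
  have hT : (d, true) ∈ v ↔
      w.idxOf (c, false) < w.idxOf (d, true) ∧ w.idxOf (d, true) < w.idxOf (c, true) := by
    have h5 := h1 (d, true)
    have h6 := h2 (d, true)
    have h7 : (d, true) ∈ v → (d, true) ∉ u := fun h h' ↦ huv _ h' _ (Or.inr h) rfl
    simp only [Prod.mk.injEq, Bool.true_eq_false, and_false, or_false, false_or] at h5 h6
    rw [e1, e2, h6, ← Nat.succ_le_iff, Nat.succ_eq_add_one, ← not_lt, h5]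
    exact ⟨fun h ↦ ⟨h7 h, Or.inr h⟩, fun ⟨h, h'⟩ ↦ h'.resolve_left h⟩
  have hF : (d, false) ∈ x ↔
      w.idxOf (c, true) < w.idxOf (d, false) ∧ w.idxOf (d, false) < w.length := by
    have h5 := h3 (d, false)
    have h6 := h4 (d, false)
    have h7 : (d, false) ∈ x → ¬((d, false) ∈ u ∨ (d, false) = (c, false) ∨ (d, false) ∈ v) :=
      fun h h' ↦ huvx _ h' _ (Or.inr h) rfl
    have h8 : (d, false) ≠ (c, true) := by simp
    rw [e2, h6, ← Nat.succ_le_iff, Nat.succ_eq_add_one, ← not_lt, add_assoc, add_assoc, h5]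
    simp only [h8, or_false, false_or]
    refine ⟨fun h ↦ ⟨h7 h, by simp [h]⟩, fun ⟨h, h'⟩ ↦ ?_⟩
    rw [← or_assoc, ← or_assoc, or_assoc (a := (d, false) ∈ u)] at h'
    exact h'.resolve_left h
  rw [Interlaced, ← and_assoc, ← hT, ← hF, List.mem_append]
  exact ⟨fun ⟨h, h'⟩ ↦ ⟨Or.inr h', h⟩, fun ⟨h, h'⟩ ↦ ⟨h', h.resolve_left fun h ↦ hd h h'⟩⟩

/-- The sum of the products of the signs of all interlaced pairs of crossings (in `S`). -/
def interlacedSum (S : Finset C) (s : C → ℤˣ) (w : List (C × Bool)) : ℤ :=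
  ∑ c ∈ S, ∑ d ∈ S, if Interlaced w c d then (s c : ℤ) * s d else 0

/-- Pairs that avoid `c` are unaffected by the switch. Pairs `(e, c)` are interlaced neither before
it, as `c` is first passed from below, nor after it, as `e` would then precede `c` in the search.
Pairs `(c, d)` are all lost, because `c` is now first passed from above. -/
theorem interlacedSum_eq_switch_add {S : Finset C} {D : LinkDiagram C} {c : C}
    {w : List (C × Bool)} (hD : D.components = [w]) (hc : D.firstUnder? = some c) (hcS : c ∈ S) :
    interlacedSum S D.sign w = interlacedSum S (D.switch c).sign (switchWord c w) +
      (D.sign c : ℤ) * ∑ d ∈ S, if Interlaced w c d then (D.sign d : ℤ) else 0 := by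
  have hp : D.passages = w := by simp [passages, hD]
  have hlt := firstUnder_iff_idxOf_lt.1 (firstUnder?_spec hc).2
  have hle := fun e ↦ @idxOf_firstUnder?_le _ _ D c e hc
  rw [hp] at hlt hle
  have hlen : (switchWord c w).length = w.length := by simp [switchWord]
  have hcc : ∀ d, ¬Interlaced (switchWord c w) c d := by
    rintro d ⟨h1, h2, -⟩
    rw [idxOf_switchWord] at h1
    rw [idxOf_switchWord _ _ (c, true)] at h2
    rw [switchPassage_self] at h1 h2
    simp only [Bool.not_true, Bool.not_false] at h1 h2
    omega
  have key : ∀ e ∈ S, (∑ d ∈ S, if Interlaced w e d then (D.sign e : ℤ) * D.sign d else 0) =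
      (∑ d ∈ S, if Interlaced (switchWord c w) e d then
        ((D.switch c).sign e : ℤ) * (D.switch c).sign d else 0) +
      if e = c then (D.sign c : ℤ) * ∑ d ∈ S, if Interlaced w c d then (D.sign d : ℤ) else 0
        else 0 := by
    intro e _
    by_cases hec : e = c
    · subst hec
      simp [hcc, Finset.mul_sum]
    · rw [if_neg hec, add_zero]
      refine Finset.sum_congr rfl fun d _ ↦ ?_
      by_cases hdc : d = c
      · subst hdc
        rw [if_neg, if_neg]
        · rintro ⟨h1, h2, h3, -⟩
          simp only [idxOf_switchWord, switchPassage_self, switchPassage_of_ne hec,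
            Bool.not_true, Bool.not_false] at h1 h2 h3
          have := hle e (by omega)
          omega
        · rintro ⟨h1, h2, h3, -⟩
          omega
      · have : Interlaced (switchWord c w) e d ↔ Interlaced w e d := by
          simp only [Interlaced, idxOf_switchWord, switchPassage_of_ne hec,
            switchPassage_of_ne hdc, hlen]
        simp only [this, switch, Function.update_of_ne hec, Function.update_of_ne hdc]
  rw [interlacedSum, Finset.sum_congr rfl key, Finset.sum_add_distrib, interlacedSum,
    Finset.sum_ite_eq' S c, if_pos hcS]

/-- The second coefficient of the Conway polynomial of a knot diagram counts the interlaced pairs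
of crossings, with signs. -/
theorem coeff_two_conway {S : Finset C} (D : LinkDiagram C) {w : List (C × Bool)}
    (hD : D.components = [w]) (hw : IsGaussWord w) (hS : ∀ x ∈ w, x.1 ∈ S) :
    D.conway.coeff 2 = interlacedSum S D.sign w := by
  induction D using switch_induction generalizing w with
  | h0 D h =>
    have hp : D.passages = w := by simp [passages, hD]
    have hnone : ∀ c d, ¬Interlaced w c d := by
      rintro c d ⟨h1, h2, -⟩
      refine not_firstUnder_of_none h c ?_
      rw [hp, firstUnder_iff_idxOf_lt]
      exact h1.trans h2
    rw [conway_of_none h, hD, interlacedSum]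
    simp [hnone, Polynomial.coeff_one]
  | h1 D c h ih =>
    have hp : D.passages = w := by simp [passages, hD]
    have hu := (firstUnder?_spec h).2
    rw [hp] at hu
    have hsw : (D.switch c).components = [switchWord c w] := by simp [switch, hD]
    have hS' : ∀ x ∈ switchWord c w, x.1 ∈ S := by
      intro x hx
      rw [mem_switchWord] at hx
      have := hS _ hx
      unfold switchPassage at this
      split_ifs at this <;> exact this
    rw [coeff_succ_conway_of_some h 1, ih hsw (hw.switchWord c) hS',
      interlacedSum_eq_switch_add hD h (hS _ hu.mem)]
    obtain ⟨u, v, x, hwe, hsm⟩ := smoothWords_singleton hw hu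
    have hcomp : (D.smooth c).components = [u ++ x, v] := by rw [smooth, hD, hsm]
    -- Pulling both passages of `c` to the front shows that the smoothed word is again a Gauss word.
    have hperm : w.Perm ((c, false) :: (c, true) :: (u ++ x ++ v)) := by
      rw [hwe, List.perm_iff_count]
      intro a
      simp only [List.count_append, List.count_cons]
      omega
    have hg := hw.perm hperm
    have hnd := hg.1
    simp only [List.nodup_cons] at hnd
    have hg' : IsGaussWord (u ++ x ++ v) := by
      refine ⟨hnd.2.2, fun e b he ↦ ?_⟩
      have hec : e ≠ c := by
        rintro rfl
        cases b
        · exact hnd.1 (List.mem_cons_of_mem _ he)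
        · exact hnd.2.1 he
      have := hg.2 e b (List.mem_cons_of_mem _ (List.mem_cons_of_mem _ he))
      simpa [hec] using this
    rw [coeff_one_conway (S := S) _ hcomp hg' fun y hy ↦ hS _ (hperm.symm.subset
      (List.mem_cons_of_mem _ (List.mem_cons_of_mem _ hy)))]
    congr 2
    refine Finset.sum_congr rfl fun d _ ↦ ?_
    -- Otherwise `d` would be first passed from below, earlier than `c`, contrary to the choice of
    -- `c`.
    have hdu : (d, false) ∈ u → (d, true) ∉ v := by
      intro hd hd'
      have h1 : (d, true) ∉ u := fun h1 ↦
        (List.nodup_append.1 hg'.1).2.2 _ (List.mem_append_left _ h1) _ hd' rfl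
      have h2 := List.idxOf_lt_length_of_mem hd
      have h3 := @idxOf_firstUnder?_le _ _ D c d h
      have hcu : (c, false) ∉ u := fun hcu ↦ hnd.1 (by simp [hcu])
      rw [hp, hwe, List.append_assoc, List.idxOf_append_of_mem hd,
        List.idxOf_append_of_notMem h1, List.idxOf_append_of_notMem hcu] at h3
      have := h3 (by omega)
      omega
    have hnd' := hw.1
    subst hwe
    simp only [interlaced_iff_mem hnd' hdu]
    rfl

/-- In a word that is sorted by `rank`, the interlaced pairs can be recognised from the ranks. -/
theorem interlaced_iff_rank {w : List (C × Bool)} {rank : C × Bool → ℕ}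
    (hr : w.Pairwise fun x y ↦ rank x < rank y) (hw : IsGaussWord w) (c d : C) :
    Interlaced w c d ↔ (c, false) ∈ w ∧ (d, false) ∈ w ∧ rank (c, false) < rank (d, true) ∧
      rank (d, true) < rank (c, true) ∧ rank (c, true) < rank (d, false) := by
  have key : ∀ x ∈ w, ∀ y ∈ w, w.idxOf x < w.idxOf y ↔ rank x < rank y := by
    have h1 : ∀ x ∈ w, ∀ y ∈ w, w.idxOf x < w.idxOf y → rank x < rank y := by
      intro x hx y hy h
      have := List.pairwise_iff_getElem.1 hr _ _ (List.idxOf_lt_length_of_mem hx)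
        (List.idxOf_lt_length_of_mem hy) h
      simpa using this
    intro x hx y hy
    refine ⟨h1 x hx y hy, fun h ↦ ?_⟩
    by_contra h'
    rcases (not_lt.1 h').lt_or_eq with h2 | h2
    · exact absurd (h1 y hy x hx h2) (by omega)
    · rw [List.idxOf_inj hy] at h2
      exact absurd h (by rw [h2]; omega)
  constructor
  · rintro ⟨h1, h2, h3, h4⟩
    have hd := List.idxOf_lt_length_iff.1 h4
    have hc' := List.idxOf_lt_length_iff.1 (h3.trans h4)
    have hc := (hw.mem_iff c).1 hc'
    have hd' := (hw.mem_iff d).2 hd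
    exact ⟨hc, hd, (key _ hc _ hd').1 h1, (key _ hd' _ hc').1 h2, (key _ hc' _ hd).1 h3⟩
  · rintro ⟨hc, hd, h1, h2, h3⟩
    have hc' := (hw.mem_iff c).2 hc
    have hd' := (hw.mem_iff d).2 hd
    exact ⟨(key _ hc _ hd').2 h1, (key _ hd' _ hc').2 h2, (key _ hc' _ hd).2 h3,
      List.idxOf_lt_length_of_mem hd⟩

end LinkDiagram

/-! ### The knot of the identity permutation -/

open LinkDiagram

theorem permutationKnot_coeff_two {N : ℕ} (p : Equiv.Perm (Fin N)) {S : Finset DiagramCrossing}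
    (hw : IsGaussWord (solidPassages p ++ dashedPassages p))
    (hS : ∀ x ∈ solidPassages p ++ dashedPassages p, x.1 ∈ S) :
    (permutationKnot p).conway.coeff 2 =
      interlacedSum S (crossingSign p) (solidPassages p ++ dashedPassages p) :=
  coeff_two_conway _ rfl hw hS

theorem flatMap_range_filter_eq_nil {m N : ℕ} {Q : ℕ → ℕ → Prop} [∀ x, DecidablePred (Q x)]
    (h : ∀ x, ∀ j < N, ¬Q x j) :
    ((List.range m).flatMap fun x ↦ (List.range N).filter fun j ↦ Q x j) = [] := by
  simp only [List.flatMap_eq_nil_iff, List.filter_eq_nil_iff, List.mem_range, decide_eq_true_eq]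
  exact fun x _ ↦ h x

/-- The list has no duplicates, so its elements determine it once there is just one. -/
theorem flatMap_range_filter_eq_singleton {m N x₀ j₀ : ℕ} {Q : ℕ → ℕ → Prop}
    [∀ x, DecidablePred (Q x)] (hx : x₀ < m) (hj : j₀ < N)
    (h : ∀ x, ∀ j < N, Q x j ↔ x = x₀ ∧ j = j₀) :
    ((List.range m).flatMap fun x ↦ (List.range N).filter fun j ↦ Q x j) = [j₀] := by
  rw [← List.perm_singleton, List.perm_ext_iff_of_nodup _ (List.nodup_singleton _)]
  · intro j
    simp only [List.mem_flatMap, List.mem_range, List.mem_filter, decide_eq_true_eq,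
      List.mem_singleton]
    constructor
    · rintro ⟨x, -, hj', hQ⟩
      exact ((h x j hj').1 hQ).2
    · rintro rfl
      exact ⟨x₀, hx, hj, (h _ _ hj).2 ⟨rfl, rfl⟩⟩
  · rw [List.nodup_flatMap]
    refine ⟨fun x _ ↦ List.nodup_range.filter _, List.nodup_range.imp fun {x y} hxy ↦ ?_⟩
    rw [Function.onFun, List.disjoint_left]
    intro j h1 h2
    simp only [List.mem_filter, List.mem_range, decide_eq_true_eq] at h1 h2
    exact hxy (((h x j h1.1).1 h1.2).1.trans ((h y j h2.1).1 h2.2).1.symm)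

section Refl

variable {N : ℕ}

theorem visited_refl {k : ℕ} (hk : k < N) : visited (Equiv.refl (Fin N)) k = N - 1 - k := by
  have : N - 1 - k < N := by omega
  simp [visited, vertexAt, this]

theorem vertexAt_refl_zero : vertexAt (Equiv.refl (Fin N)) 0 = 0 := by
  simp [vertexAt]

theorem pieceStart_refl {k : ℕ} (hk : k < N) :
    pieceStart (Equiv.refl (Fin N)) k = 2 * (N - k) + 1 := by
  unfold pieceStart
  split_ifs with h
  · subst h
    rfl
  · rw [visited_refl (by omega), overPlace, vertexAt_refl_zero, if_neg (by omega)]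
    omega

theorem pieceEnd_refl {k : ℕ} (hk : k < N) :
    pieceEnd (Equiv.refl (Fin N)) k = if k + 1 = N then 0 else 2 * (N - k) := by
  unfold pieceEnd
  split_ifs with h
  · rfl
  · rw [visited_refl hk, underPlace, vertexAt_refl_zero, if_neg (by omega)]
    omega

/-- The pieces occupy disjoint intervals: `[2m, 2m + 1]` with `m = N - k` for all but the last
piece, and `[0, 3]` for the last. -/
theorem piecesCrossing_refl {i : ℕ} (hi : i < N) : piecesCrossing (Equiv.refl (Fin N)) i = [] := by
  unfold piecesCrossing
  rw [List.append_eq_nil_iff]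
  constructor <;> refine flatMap_range_filter_eq_nil fun x j hj ↦ ?_ <;>
  · simp only [pieceLeft, pieceRight, pieceStart_refl hi, pieceEnd_refl hi, pieceStart_refl hj,
      pieceEnd_refl hj]
    split_ifs <;> omega

theorem solidPassages_refl : solidPassages (Equiv.refl (Fin N)) =
    (List.range N).flatMap fun v ↦ if v = 0 then [] else
      [(DiagramCrossing.over v, false), (DiagramCrossing.under v, true)] := by
  simp [solidPassages, vertexAt_refl_zero]

theorem dashedPassages_refl : dashedPassages (Equiv.refl (Fin N)) =
    (List.range N).flatMap fun i ↦ if i + 1 < N then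
      [(DiagramCrossing.under (N - 1 - i), false), (DiagramCrossing.over (N - 1 - i), true)]
      else [] := by
  unfold dashedPassages
  refine List.flatMap_congr fun i hi ↦ ?_
  rw [List.mem_range] at hi
  simp [piecePassages, piecesCrossing_refl hi, visited_refl hi]

/-- The position of the passages in the diagram of the identity. -/
def reflRank (N : ℕ) : DiagramCrossing × Bool → ℕ
  | (.over v, false) => 2 * v
  | (.under v, true) => 2 * v + 1
  | (.under v, false) => 4 * N - 2 * v
  | (.over v, true) => 4 * N - 2 * v + 1
  | (.dashed _ _, _) => 0

theorem mem_passages_refl (c : DiagramCrossing) (b : Bool) :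
    (c, b) ∈ solidPassages (Equiv.refl (Fin N)) ++ dashedPassages (Equiv.refl (Fin N)) ↔
      ∃ v, 0 < v ∧ v < N ∧ (c = .over v ∨ c = .under v) := by
  rw [solidPassages_refl, dashedPassages_refl, List.mem_append, List.mem_flatMap,
    List.mem_flatMap]
  simp only [List.mem_range]
  constructor
  · rintro (⟨v, hv, h⟩ | ⟨i, hi, h⟩)
    · split_ifs at h with h0
      · simp at h
      · refine ⟨v, by omega, hv, ?_⟩
        simp only [List.mem_cons, Prod.mk.injEq, List.not_mem_nil, or_false] at h
        tauto
    · split_ifs at h with h0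
      · refine ⟨N - 1 - i, by omega, by omega, ?_⟩
        simp only [List.mem_cons, Prod.mk.injEq, List.not_mem_nil, or_false] at h
        tauto
      · simp at h
  · rintro ⟨v, h0, hv, h⟩
    -- The vertex `v` is visited after the piece `N - 1 - v`.
    have h1 : N - 1 - v + 1 < N := by omega
    have h2 : N - 1 - (N - 1 - v) = v := by omega
    rcases h with rfl | rfl <;> cases b
    · exact Or.inl ⟨v, hv, by simp [h0.ne']⟩
    · exact Or.inr ⟨N - 1 - v, by omega, by simp [h1, h2]⟩
    · exact Or.inr ⟨N - 1 - v, by omega, by simp [h1, h2]⟩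
    · exact Or.inl ⟨v, hv, by simp [h0.ne']⟩

theorem pairwise_passages_refl :
    (solidPassages (Equiv.refl (Fin N)) ++ dashedPassages (Equiv.refl (Fin N))).Pairwise
      fun x y ↦ reflRank N x < reflRank N y := by
  rw [solidPassages_refl, dashedPassages_refl, List.pairwise_append, List.pairwise_flatMap,
    List.pairwise_flatMap]
  refine ⟨⟨fun v _ ↦ ?_, List.pairwise_lt_range.imp_of_mem fun {a b} ha hb hab ↦ ?_⟩,
    ⟨fun v _ ↦ ?_, List.pairwise_lt_range.imp_of_mem fun {a b} ha hb hab ↦ ?_⟩, ?_⟩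
  · split_ifs <;> simp [reflRank]
  · split_ifs <;> simp [reflRank]
    omega
  · split_ifs <;> simp [reflRank]
  · split_ifs <;> simp [reflRank]
    omega
  · intro x hx y hy
    simp only [List.mem_flatMap, List.mem_range] at hx hy
    obtain ⟨v, hv, hx⟩ := hx
    obtain ⟨i, hi, hy⟩ := hy
    split_ifs at hx with h1
    · simp at hx
    split_ifs at hy with h2
    · simp only [List.mem_cons, List.not_mem_nil, or_false] at hx hy
      rcases hx with rfl | rfl <;> rcases hy with rfl | rfl <;> simp only [reflRank] <;> omega
    · simp at hy

theorem isGaussWord_of_pairwise {C : Type*} {w : List (C × Bool)} {rank : C × Bool → ℕ}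
    (hr : w.Pairwise fun x y ↦ rank x < rank y) {P : C → Prop}
    (hw : ∀ c b, (c, b) ∈ w ↔ P c) : IsGaussWord w :=
  ⟨hr.imp fun h e ↦ h.ne (congrArg rank e), fun c b h ↦ (hw c _).2 ((hw c b).1 h)⟩

/-- In an interlaced pair `c` is first passed from below and `d` from above, so `c = over v` and `d
= under v'`. The solid line then requires `v ≤ v'`, and the dashed line, which visits the vertices
in the opposite order, requires `v' < v`. -/
theorem coeff_two_conway_refl : (permutationKnot (Equiv.refl (Fin N))).conway.coeff 2 = 0 := by
  have hw := isGaussWord_of_pairwise (pairwise_passages_refl (N := N)) mem_passages_refl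
  rw [permutationKnot_coeff_two (S := ((solidPassages (Equiv.refl (Fin N)) ++
    dashedPassages (Equiv.refl (Fin N))).map Prod.fst).toFinset) _ hw
    fun x hx ↦ List.mem_toFinset.2 (List.mem_map_of_mem hx)]
  refine Finset.sum_eq_zero fun c _ ↦ Finset.sum_eq_zero fun d _ ↦ if_neg ?_
  rw [interlaced_iff_rank pairwise_passages_refl hw, mem_passages_refl, mem_passages_refl]
  rintro ⟨⟨v, hv0, hv, hc⟩, ⟨v', hv0', hv', hd⟩, h1, h2, h3⟩
  rcases hc with rfl | rfl <;> rcases hd with rfl | rfl <;> simp only [reflRank] at h1 h2 h3 <;>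
    omega

end Refl

/-! ### The knot of the reversal -/

section Rev

variable {n : ℕ}

theorem visited_rev {k : ℕ} (hk : k ≤ n) : visited (Fin.revPerm (n := n + 1)) k = k := by
  have : n - k < n + 1 := by omega
  simp [visited, vertexAt, this, Fin.val_rev]
  omega

theorem vertexAt_rev_zero : vertexAt (Fin.revPerm (n := n + 1)) 0 = n := by
  simp [vertexAt]

theorem pieceStart_rev {k : ℕ} (hk : k ≤ n) :
    pieceStart (Fin.revPerm (n := n + 1)) k = if k = 0 then 2 * n + 3 else 2 * k := by
  unfold pieceStart
  split_ifs with h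
  · rfl
  · rw [visited_rev (by omega), overPlace, vertexAt_rev_zero, if_pos (by omega)]
    omega

theorem pieceEnd_rev {k : ℕ} (hk : k ≤ n) :
    pieceEnd (Fin.revPerm (n := n + 1)) k = if k = n then 0 else 2 * k + 1 := by
  unfold pieceEnd
  simp only [Nat.add_right_cancel_iff]
  split_ifs with h
  · rfl
  · rw [visited_rev hk, underPlace, vertexAt_rev_zero, if_pos (by omega)]

/-- The intervals are `[1, 2n + 3]` for the piece `0`, `[0, 2n]` for the piece `n` and `[2k, 2k +
1]` for the others. Only the first two overlap without being nested; the crossing lies on the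
vertical line of the piece `0` at place `1`. -/
theorem piecesCrossing_rev_zero (hn : 0 < n) :
    piecesCrossing (Fin.revPerm (n := n + 1)) 0 = [n] := by
  unfold piecesCrossing
  rw [flatMap_range_filter_eq_singleton (x₀ := 2 * n) (j₀ := n) (by omega) (by omega),
    flatMap_range_filter_eq_nil, List.append_nil]
  all_goals
    intro x j hj
    simp only [pieceLeft, pieceRight, pieceStart_rev (Nat.zero_le n), pieceEnd_rev (Nat.zero_le n),
      pieceStart_rev (Nat.lt_succ_iff.1 hj), pieceEnd_rev (Nat.lt_succ_iff.1 hj)]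
    split_ifs <;> omega

theorem piecesCrossing_rev_last (hn : 0 < n) :
    piecesCrossing (Fin.revPerm (n := n + 1)) n = [0] := by
  unfold piecesCrossing
  rw [flatMap_range_filter_eq_nil, List.nil_append,
    flatMap_range_filter_eq_singleton (x₀ := 1) (j₀ := 0) (by omega) (by omega)]
  all_goals
    intro x j hj
    simp only [pieceLeft, pieceRight, pieceStart_rev le_rfl, pieceEnd_rev le_rfl,
      pieceStart_rev (Nat.lt_succ_iff.1 hj), pieceEnd_rev (Nat.lt_succ_iff.1 hj)]
    split_ifs <;> omega

theorem piecesCrossing_rev_of_lt {i : ℕ} (h0 : 0 < i) (hi : i < n) :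
    piecesCrossing (Fin.revPerm (n := n + 1)) i = [] := by
  unfold piecesCrossing
  rw [flatMap_range_filter_eq_nil, flatMap_range_filter_eq_nil, List.append_nil]
  all_goals
    intro x j hj
    simp only [pieceLeft, pieceRight, pieceStart_rev hi.le, pieceEnd_rev hi.le,
      pieceStart_rev (Nat.lt_succ_iff.1 hj), pieceEnd_rev (Nat.lt_succ_iff.1 hj)]
    split_ifs <;> omega

theorem solidPassages_rev : solidPassages (Fin.revPerm (n := n + 1)) =
    (List.range n).flatMap fun v ↦
      [(DiagramCrossing.under v, true), (DiagramCrossing.over v, false)] := by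
  unfold solidPassages
  rw [List.range_succ, List.flatMap_append, vertexAt_rev_zero]
  simp only [List.flatMap_cons, List.flatMap_nil, if_true, List.append_nil]
  refine List.flatMap_congr fun i hi ↦ ?_
  rw [List.mem_range] at hi
  simp [hi, hi.ne]

theorem dashedPassages_rev (hn : 0 < n) : dashedPassages (Fin.revPerm (n := n + 1)) =
    (DiagramCrossing.dashed 0 n, true) :: ((List.range n).flatMap fun v ↦
      [(DiagramCrossing.under v, false), (DiagramCrossing.over v, true)]) ++
      [(DiagramCrossing.dashed 0 n, false)] := by
  have h : dashedPassages (Fin.revPerm (n := n + 1)) = (List.range (n + 1)).flatMap fun i ↦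
      (if i = 0 then [(DiagramCrossing.dashed 0 n, true)] else
        if i = n then [(DiagramCrossing.dashed 0 n, false)] else []) ++
      if i < n then [(DiagramCrossing.under i, false), (DiagramCrossing.over i, true)] else [] := by
    unfold dashedPassages
    refine List.flatMap_congr fun i hi ↦ ?_
    rw [List.mem_range, Nat.lt_succ_iff] at hi
    rw [visited_rev hi]
    simp only [Nat.add_lt_add_iff_right]
    congr 1
    unfold piecePassages
    split_ifs with h1 h2 h3 h4 h5
    all_goals first
      | subst h2; simp [piecesCrossing_rev_zero hn, hn]
      | subst h3; simp [piecesCrossing_rev_last hn]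
      | subst h4; simp [piecesCrossing_rev_zero hn, hn]
      | subst h5; simp [piecesCrossing_rev_last hn]
      | simp [piecesCrossing_rev_of_lt (show 0 < i by omega) (show i < n by omega)]
  rw [h, List.range_succ, List.flatMap_append]
  congr 1
  -- Piece `0` is split off; the pieces `i + 1` with `i < m` are strictly between the first and the
  -- last, hence free of crossings.
  · obtain ⟨m, rfl⟩ : ∃ m, n = m + 1 := ⟨n - 1, by omega⟩
    rw [List.range_succ_eq_map, List.flatMap_cons, List.flatMap_cons, List.flatMap_map,
      List.flatMap_map]
    simp only [if_true, Nat.succ_pos, List.cons_append, List.nil_append]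
    congr 3
    refine List.flatMap_congr fun i hi ↦ ?_
    rw [List.mem_range] at hi
    have : i ≠ m := hi.ne
    simp [hi, this]
  · simp [hn.ne']

/-- The position of the passages in the diagram of the reversal. -/
def revRank (n : ℕ) : DiagramCrossing × Bool → ℕ
  | (.under v, true) => 2 * v
  | (.over v, false) => 2 * v + 1
  | (.dashed _ _, true) => 2 * n
  | (.under v, false) => 2 * n + 1 + 2 * v
  | (.over v, true) => 2 * n + 2 + 2 * v
  | (.dashed _ _, false) => 4 * n + 1

theorem mem_passages_rev (hn : 0 < n) (c : DiagramCrossing) (b : Bool) :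
    (c, b) ∈ solidPassages (Fin.revPerm (n := n + 1)) ++
      dashedPassages (Fin.revPerm (n := n + 1)) ↔
      (∃ v < n, c = .over v ∨ c = .under v) ∨ c = .dashed 0 n := by
  rw [solidPassages_rev, dashedPassages_rev hn]
  cases b <;> simp <;> grind

theorem pairwise_passages_rev (hn : 0 < n) :
    (solidPassages (Fin.revPerm (n := n + 1)) ++ dashedPassages (Fin.revPerm (n := n + 1))).Pairwise
      fun x y ↦ revRank n x < revRank n y := by
  have h (x y : ℕ → DiagramCrossing × Bool)
      (h1 : ∀ v < n, revRank n (x v) < revRank n (y v))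
      (h2 : ∀ v v', v < v' → v' < n → revRank n (y v) < revRank n (x v'))  :
      ((List.range n).flatMap fun v ↦ [x v, y v]).Pairwise
        fun x y ↦ revRank n x < revRank n y := by
    rw [List.pairwise_flatMap]
    refine ⟨fun v hv ↦ by simpa using h1 v (List.mem_range.1 hv),
      List.pairwise_lt_range.imp_of_mem fun {a b} ha hb hab ↦ ?_⟩
    rw [List.mem_range] at ha hb
    have := h1 a ha
    have := h1 b hb
    have := h2 a b hab hb
    simp only [List.mem_cons, List.not_mem_nil, or_false]
    rintro _ (rfl | rfl) _ (rfl | rfl) <;> omega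
  rw [solidPassages_rev, dashedPassages_rev hn, List.pairwise_append, List.pairwise_append,
    List.pairwise_cons]
  refine ⟨h _ _ ?_ ?_, ⟨⟨?_, h _ _ ?_ ?_⟩, List.pairwise_singleton _ _, ?_⟩, ?_⟩
  · simp [revRank]
  · simp only [revRank]
    omega
  · simp only [List.mem_flatMap, List.mem_range, List.mem_cons, List.not_mem_nil, or_false]
    rintro _ ⟨v, hv, rfl | rfl⟩ <;> simp only [revRank] <;> omega
  · simp [revRank]
  · simp only [revRank]
    omega
  · simp only [List.mem_flatMap, List.mem_range, List.mem_cons, List.not_mem_nil, or_false]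
    rintro _ (rfl | ⟨v, hv, rfl | rfl⟩) _ rfl <;> simp only [revRank] <;> omega
  · simp only [List.mem_append, List.mem_flatMap, List.mem_range, List.mem_cons,
      List.not_mem_nil, or_false]
    rintro _ ⟨v, hv, rfl | rfl⟩ _ ((rfl | ⟨v', hv', rfl | rfl⟩) | rfl) <;>
      simp only [revRank] <;> omega

/-! ### Counting the interlaced pairs of the reversal -/

/-- The crossings of the diagram of the reversal. -/
def revCrossings (n : ℕ) : Finset DiagramCrossing :=
  ((Finset.range n).image .over ∪ (Finset.range n).image .under) ∪ {.dashed 0 n}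

theorem sum_revCrossings (f : DiagramCrossing → ℤ) : ∑ c ∈ revCrossings n, f c =
    (∑ v ∈ Finset.range n, f (.over v) + ∑ v ∈ Finset.range n, f (.under v)) +
      f (.dashed 0 n) := by
  rw [revCrossings, Finset.sum_union, Finset.sum_union, Finset.sum_image, Finset.sum_image,
    Finset.sum_singleton]
  · intro a _ b _ h
    simpa using h
  · intro a _ b _ h
    simpa using h
  · rw [Finset.disjoint_left]
    simp
  · rw [Finset.disjoint_left]
    simp only [Finset.mem_union, Finset.mem_image, Finset.mem_singleton]
    rintro _ (⟨_, -, rfl⟩ | ⟨_, -, rfl⟩) <;> exact nofun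

/-- Both pieces run from right to left, and the piece `0` has the larger right end point. -/
theorem crossingSign_rev_dashed (hn : 0 < n) :
    crossingSign (Fin.revPerm (n := n + 1)) (.dashed 0 n) = 1 := by
  simp [crossingSign, pieceRight, pieceDirection, pieceStart_rev, pieceEnd_rev, hn.ne', hn.ne]

theorem sum_range_sum_range_ite_lt (n : ℕ) :
    (∑ i ∈ Finset.range n, ∑ j ∈ Finset.range n, if i < j then 1 else 0) = n * (n - 1) / 2 := by
  rw [Finset.sum_comm, ← Finset.sum_range_id]
  refine Finset.sum_congr rfl fun j hj ↦ ?_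
  rw [Finset.mem_range] at hj
  rw [Finset.sum_boole, Nat.cast_id]
  have : (Finset.range n).filter (· < j) = Finset.range j := by
    ext i
    simp
    omega
  rw [this, Finset.card_range]

theorem coeff_two_conway_rev (hn : 0 < n) :
    (permutationKnot (Fin.revPerm (n := n + 1))).conway.coeff 2 = ((n + 1).choose 2 : ℕ) := by
  have hr := pairwise_passages_rev hn
  have hm := mem_passages_rev hn
  have hw := isGaussWord_of_pairwise hr hm
  rw [permutationKnot_coeff_two (S := revCrossings n) _ hw]
  · generalize solidPassages (Fin.revPerm (n := n + 1)) ++ dashedPassages Fin.revPerm = w at hr hw hm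
    have hI := interlaced_iff_rank hr hw
    -- The first member of an interlaced pair is first passed from below, which leaves only the
    -- crossings `over i`.
    have hun : ∀ v d, ¬Interlaced w (.under v) d := by
      intro v d h
      have h1 := ((hI _ _).1 h).2.2
      simp only [revRank] at h1
      omega
    have hdn : ∀ d, ¬Interlaced w (.dashed 0 n) d := by
      intro d h
      have h1 := ((hI _ _).1 h).2.2
      simp only [revRank] at h1
      omega
    have hoo : ∀ i j, ¬Interlaced w (.over i) (.over j) := by
      intro i j h
      have h1 := ((hI _ _).1 h).2.2
      simp only [revRank] at h1
      omega
    have hou : ∀ i ∈ Finset.range n, ∀ j ∈ Finset.range n,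
        (Interlaced w (.over i) (.under j) ↔ i < j) := by
      intro i hi j hj
      rw [Finset.mem_range] at hi hj
      rw [hI, hm, hm]
      simp [revRank, hi, hj]
      omega
    have hod : ∀ i ∈ Finset.range n, Interlaced w (.over i) (.dashed 0 n) := by
      intro i hi
      rw [Finset.mem_range] at hi
      rw [hI, hm, hm]
      simp [revRank, hi]
      omega
    have hsum : ∀ i ∈ Finset.range n, (∑ d ∈ revCrossings n, if Interlaced w (.over i) d then
        (crossingSign (Fin.revPerm (n := n + 1)) (.over i) : ℤ) *
          crossingSign (Fin.revPerm (n := n + 1)) d else 0) =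
        ((∑ j ∈ Finset.range n, if i < j then 1 else 0 : ℕ) : ℤ) + 1 := by
      intro i hi
      rw [sum_revCrossings, if_pos (hod i hi), crossingSign_rev_dashed hn, Nat.cast_sum]
      simp only [hoo, if_false, Finset.sum_const_zero, zero_add]
      congr 1
      refine Finset.sum_congr rfl fun j hj ↦ ?_
      simp [hou i hi j hj, crossingSign]
    rw [interlacedSum, sum_revCrossings, Finset.sum_congr rfl hsum]
    simp only [hun, hdn, if_false, Finset.sum_const_zero, add_zero]
    -- The sum of `#{j | i < j < n} + 1` over `i < n` is `n.choose 2 + n`; Pascal's rule concludes.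
    rw [Finset.sum_add_distrib, ← Nat.cast_sum, sum_range_sum_range_ite_lt, ← Nat.choose_two_right,
      Finset.sum_const, Finset.card_range, Nat.choose_succ_succ' n 1, Nat.choose_one_right]
    push_cast
    simp [add_comm]
  · rintro ⟨c, b⟩ hc
    rw [hm] at hc
    simp only [revCrossings, Finset.mem_union, Finset.mem_image, Finset.mem_range,
      Finset.mem_singleton]
    grind

end Rev

/-! ### Definite and maximally indefinite causal orders -/

section CausalOrder

variable {c : ℝ} {d N : ℕ} {M M' : Type*}
  [TopologicalSpace M] [ChartedSpace (EuclideanSpace ℝ (Fin d)) M] [IsManifold (𝓡 d) ∞ M]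
  [TopologicalSpace M'] [ChartedSpace (EuclideanSpace ℝ (Fin d)) M'] [IsManifold (𝓡 d) ∞ M']

theorem causalOrder_antisymm (A : EventSpacetime c d N M) (a b : Fin N) :
    causalOrder A b a = -causalOrder A a b := by
  rw [causalOrder, causalOrder, ← neg_sub, Left.sign_neg]
  cases SignType.sign (A.τ b - A.τ a) <;> rfl

/-- Events at distinct points of `γ₀` have distinct proper times. -/
theorem causalOrder_eq_one_or (A : EventSpacetime c d N M) {a b : Fin N} (h : a ≠ b) :
    causalOrder A a b = 1 ∨ causalOrder A a b = -1 := by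
  have hne : A.τ b - A.τ a ≠ 0 :=
    sub_ne_zero.2 fun e ↦ h (A.distinct (by simp only [e]))
  rcases lt_or_gt_of_ne hne with h | h
  · exact Or.inr (by simp [causalOrder, sign_neg h])
  · exact Or.inl (by simp [causalOrder, sign_pos h])

theorem sum_card_Ioi (N : ℕ) : ∑ i : Fin N, (Finset.Ioi i).card = N.choose 2 := by
  simp only [Fin.card_Ioi]
  rw [Fin.sum_univ_eq_sum_range fun i ↦ N - 1 - i, Finset.sum_range_reflect fun i ↦ i,
    Finset.sum_range_id, Nat.choose_two_right]

theorem sum_sum_Ioi_const (N : ℕ) (k : ℤ) :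
    ∑ i : Fin N, ∑ _j ∈ Finset.Ioi i, k = N.choose 2 * k := by
  simp only [Finset.sum_const, nsmul_eq_mul]
  rw [← Finset.sum_mul, ← Nat.cast_sum, sum_card_Ioi]

/-- A sum that attains its termwise upper bound attains it in every term. -/
theorem eq_const_of_sum_sum_Ioi {f : Fin N → Fin N → ℤ} {k : ℤ}
    (hf : ∀ i j, i < j → f i j ≤ k) (h : ∑ i, ∑ j ∈ Finset.Ioi i, f i j = N.choose 2 * k)
    {i j : Fin N} (hij : i < j) : f i j = k := by
  rw [← sum_sum_Ioi_const] at h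
  have h1 : ∀ i ∈ Finset.univ, ∑ j ∈ Finset.Ioi i, f i j ≤ ∑ _j ∈ Finset.Ioi i, k :=
    fun i _ ↦ Finset.sum_le_sum fun j hj ↦ hf i j (Finset.mem_Ioi.1 hj)
  have h2 := (Finset.sum_eq_sum_iff_of_le h1).1 h i (Finset.mem_univ i)
  exact (Finset.sum_eq_sum_iff_of_le fun j hj ↦ hf i j (Finset.mem_Ioi.1 hj)).1 h2 j
    (Finset.mem_Ioi.2 hij)

variable {A : EventSpacetime c d N M} {B : EventSpacetime c d N M'}

theorem IsDefinite.causalOrder_eq (h : IsDefinite A B) (a b : Fin N) :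
    causalOrder B a b = causalOrder A a b := by
  have key : ∀ a b, a < b → causalOrder B a b = causalOrder A a b := by
    intro a b hab
    have h1 : pairwiseOrder A B a b = 1 := by
      refine eq_const_of_sum_sum_Ioi (fun i j hij ↦ ?_) (by rw [mul_one]; exact h) hab
      rw [pairwiseOrder]
      rcases causalOrder_eq_one_or A hij.ne with e | e <;>
        rcases causalOrder_eq_one_or B hij.ne with e' | e' <;> simp [e, e']
    rw [pairwiseOrder] at h1
    rcases causalOrder_eq_one_or A hab.ne with e | e <;>
      rcases causalOrder_eq_one_or B hab.ne with e' | e' <;> simp [e, e'] at h1 ⊢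
  rcases lt_trichotomy a b with hab | rfl | hab
  · exact key a b hab
  · simp [causalOrder]
  · rw [causalOrder_antisymm B b a, causalOrder_antisymm A b a, key b a hab]

theorem IsMaximallyIndefinite.causalOrder_eq (h : IsMaximallyIndefinite A B) (a b : Fin N) :
    causalOrder B a b = -causalOrder A a b := by
  have key : ∀ a b, a < b → causalOrder B a b = -causalOrder A a b := by
    intro a b hab
    -- A minimal sum is treated as a maximal one by negating the terms.
    have h1 : -pairwiseOrder A B a b = 1 := by
      refine eq_const_of_sum_sum_Ioi (f := fun i j ↦ -pairwiseOrder A B i j)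
        (fun i j hij ↦ ?_) ?_ hab
      · rw [pairwiseOrder]
        rcases causalOrder_eq_one_or A hij.ne with e | e <;>
          rcases causalOrder_eq_one_or B hij.ne with e' | e' <;> simp [e, e']
      · simp only [Finset.sum_neg_distrib]
        rw [mul_one, neg_eq_iff_eq_neg]
        exact h
    rw [pairwiseOrder] at h1
    rcases causalOrder_eq_one_or A hab.ne with e | e <;>
      rcases causalOrder_eq_one_or B hab.ne with e' | e' <;> simp [e, e'] at h1 ⊢
  rcases lt_trichotomy a b with hab | rfl | hab
  · exact key a b hab
  · simp [causalOrder]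
  · rw [causalOrder_antisymm B b a, causalOrder_antisymm A b a, key b a hab]

theorem orderedEvents_relativeOrder (A : EventSpacetime c d N M) (B : EventSpacetime c d N M')
    (i : Fin N) : orderedEvents A (relativeOrder A B i) = orderedEvents B i := by
  simp [relativeOrder]

/-- A finite chain has no order automorphism but the identity. -/
theorem Fin.perm_eq_refl_of_strictMono {σ : Equiv.Perm (Fin N)} (h : StrictMono σ) :
    σ = Equiv.refl _ := by
  have := Subsingleton.elim (h.orderIsoOfSurjective _ σ.surjective) (OrderIso.refl _)
  ext i
  exact congrArg (fun f : Fin N ≃o Fin N ↦ (f i : ℕ)) this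

theorem IsDefinite.relativeOrder_eq (h : IsDefinite A B) : relativeOrder A B = Equiv.refl _ := by
  refine Fin.perm_eq_refl_of_strictMono fun i j hij ↦ ?_
  rw [orderedEvents_spec A, orderedEvents_relativeOrder, orderedEvents_relativeOrder,
    ← h.causalOrder_eq]
  exact (orderedEvents_spec B i j).1 hij

theorem IsMaximallyIndefinite.relativeOrder_eq (h : IsMaximallyIndefinite A B) :
    relativeOrder A B = Fin.revPerm := by
  -- The relative order is strictly decreasing, so reversing its argument first makes it strictly
  -- increasing.
  have : (Fin.revPerm.trans (relativeOrder A B)) = Equiv.refl _ := by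
    refine Fin.perm_eq_refl_of_strictMono fun i j hij ↦ ?_
    rw [orderedEvents_spec A, Equiv.trans_apply, Equiv.trans_apply, orderedEvents_relativeOrder,
      orderedEvents_relativeOrder, causalOrder_antisymm, ← h.causalOrder_eq]
    exact (orderedEvents_spec B _ _).1 (Fin.rev_lt_rev.2 hij)
  ext i
  have h1 := DFunLike.congr_fun this (Fin.rev i)
  simp only [Equiv.trans_apply, Fin.revPerm_apply, Fin.rev_rev, Equiv.refl_apply] at h1
  rw [h1, Fin.revPerm_apply]

theorem IsDefinite.causalIndefiniteness_eq (h : IsDefinite A B) :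
    causalIndefiniteness A B = 0 := by
  simp [causalIndefiniteness, h.causalOrder_eq, absPowZero]

theorem IsMaximallyIndefinite.causalIndefiniteness_eq (h : IsMaximallyIndefinite A B) :
    causalIndefiniteness A B = N.choose 2 := by
  rw [← mul_one (N.choose 2 : ℤ), ← sum_sum_Ioi_const]
  refine Finset.sum_congr rfl fun i _ ↦ Finset.sum_congr rfl fun j hj ↦ ?_
  rcases causalOrder_eq_one_or A (Finset.mem_Ioi.1 hj).ne with e | e <;>
    simp [absPowZero, h.causalOrder_eq, e]

theorem IsDefinite.coeff_two_conway (h : IsDefinite A B) :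
    (causalKnot A B).conway.coeff 2 = 0 := by
  rw [causalKnot, h.relativeOrder_eq, coeff_two_conway_refl]

theorem IsMaximallyIndefinite.coeff_two_conway (h : IsMaximallyIndefinite A B) :
    (causalKnot A B).conway.coeff 2 = N.choose 2 := by
  rw [causalKnot, h.relativeOrder_eq]
  -- With fewer than two events the reversal is the identity, and the first and last dashed pieces
  -- are not two distinct pieces that could cross.
  obtain _ | _ | n := N
  · rw [Subsingleton.elim Fin.revPerm (Equiv.refl (Fin 0)), coeff_two_conway_refl]
    rfl
  · rw [Subsingleton.elim Fin.revPerm (Equiv.refl (Fin 1)), coeff_two_conway_refl]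
    rfl
  · exact coeff_two_conway_rev n.succ_pos

end CausalOrder

theorem mainTheorem2 {c : ℝ} (hc : 0 < c) {d N : ℕ} {M M' : Type*}
    [TopologicalSpace M] [ChartedSpace (EuclideanSpace ℝ (Fin d)) M] [IsManifold (𝓡 d) ∞ M]
    [TopologicalSpace M'] [ChartedSpace (EuclideanSpace ℝ (Fin d)) M'] [IsManifold (𝓡 d) ∞ M']
    (A : EventSpacetime c d N M) (B : EventSpacetime c d N M') :
    (IsDefinite A B ∨ IsMaximallyIndefinite A B →
      (causalKnot A B).conway.coeff 2 = causalIndefiniteness A B) ∧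
    (IsDefinite A B → (causalKnot A B).conway.coeff 2 = 0) ∧
    (IsMaximallyIndefinite A B →
      (causalKnot A B).conway.coeff 2 = ((N * (N - 1) / 2 : ℕ) : ℤ)) := by
  refine ⟨?_, IsDefinite.coeff_two_conway, fun h ↦ ?_⟩
  · rintro (h | h)
    · rw [h.coeff_two_conway, h.causalIndefiniteness_eq]
    · rw [h.coeff_two_conway, h.causalIndefiniteness_eq]
  · rw [h.coeff_two_conway, Nat.choose_two_right]
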